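/- Let $(M^n,g,p)$ be an initial data set: $M$ is a smooth $n$-manifold, possibly with boundary, $g$ is a smooth Riemannian metric and $p$ is a smooth symmetric $2$-tensor on $M$. Put $\mu=\tfrac12\big(R_g+(\operatorname{tr}_g p)^2-|p|_g^2\big)$ and $J=\operatorname{div}_g p-d(\operatorname{tr}_g p)$. Suppose that $(M,g)$ is spin, with a fixed spin structure. Let $\Delta$ be a finite-dimensional complex representation of the Clifford algebra generated by $e^0,e^1,\dots,e^n$ with $e^0e^0=1$, $e^ie^i=-1$ for $i\ge 1$ and with distinct generators anticommuting. Let $\Delta$ carry a positive definite Hermitian inner product $\langle\cdot,\cdot\rangle$ for which $e^0\cdot$ is symmetric and every $e^i\cdot$ $(i\geq1)$ is skew-symmetric. Let $\mathbb S\to M$ be the associated hypersurface spinor bundle, with Clifford multiplication by $e^0$ and by the dual coframes $e^1,\dots,e^n$ of local orthonormal frames $e_1,\dots,e_n$ of $M$. Put $(\phi,\psi)=\langle e^0\cdot\phi,\psi\rangle$, so that $\langle\phi,\psi\rangle=(e^0\cdot\phi,\psi)$. Let $\nabla$ be the lift to $\mathbb S$ of the Levi-Civita connection of $g$ and let $$\tilde\nabla_v\phi=\nabla_v\phi-\tfrac12\sum_j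 p(v,e_j)\,e^j\cdot e^0\cdot\phi$$ be the spacetime spin connection. For a $C^1$ spinor $\phi$, that is, a $C^1$ section of $\mathbb S$, put $$N=\langle\phi,\phi\rangle,\qquad X=\sum_j X^je_j,\quad X^j=(e^j\cdot\phi,\phi)\in\mathbb R .$$ (i) If $\tilde\nabla\phi=0$ on $M$, then $X$ is a $C^1$ vector field and, on $M$, $$L_Xg+2Np=0,\qquad d\big(N^2-|X|_g^2\big)=0 .$$ (ii) If $\mu\ge|J|_g$ on $M$ and $\operatorname{Re}\langle(\mu-J\cdot e^0\cdot)\phi,\phi\rangle=0$ on $M$, where $J\cdot=\sum_i J(e_i)\,e^i\cdot$, then, on $M$, $$\mu N+\langle J,X\rangle=0,\qquad \mu X^k+NJ^k=0\quad(k=1,\dots,n).$$ Here $\langle J,X\rangle=J(X)$ and $J^k=J(e_k)$. -/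

import Mathlib

open scoped Manifold ContDiff Bundle

noncomputable section

namespace InitialDataSpin

/-! ## Initial data sets -/

/-- The model vector space `ℝⁿ` of an `n`-dimensional manifold. -/
abbrev Model (n : ℕ) : Type := EuclideanSpace ℝ (Fin n)

/-- An initial data set `(M, g, p)`: a smooth Riemannian metric `g` and a smooth symmetric
covariant 2-tensor `p` on the manifold `M` (with or without boundary). -/
structure InitialData {n : ℕ} {H : Type*} [TopologicalSpace H]
    (I : ModelWithCorners ℝ (Model n) H)
    (M : Type*) [TopologicalSpace M] [ChartedSpace H M] [IsManifold I ∞ M] where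
  /-- the Riemannian metric -/
  g : Bundle.ContMDiffRiemannianMetric I ∞ (Model n) (fun x : M => TangentSpace I x)
  /-- the symmetric 2-tensor (second fundamental form) -/
  p : ∀ x : M, TangentSpace I x →L[ℝ] TangentSpace I x →L[ℝ] ℝ
  p_symm : ∀ (x : M) (v w : TangentSpace I x), p x v w = p x w v
  p_contMDiff : ContMDiff I (I.prod 𝓘(ℝ, Model n →L[ℝ] Model n →L[ℝ] ℝ)) ∞
    (fun x : M => Bundle.TotalSpace.mk' (Model n →L[ℝ] Model n →L[ℝ] ℝ)
      (E := fun x : M => TangentSpace I x →L[ℝ] TangentSpace I x →L[ℝ] ℝ) x (p x))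

section Coordinates

/-! ## Tensor calculus in the coordinates of a chart

All objects carry a point `c : M`, and are written in the chart of `M` at `c`; they are meant at
points `y` of the domain of that chart. -/

variable {n : ℕ} {H : Type*} [TopologicalSpace H] {I : ModelWithCorners ℝ (Model n) H}
  {M : Type*} [TopologicalSpace M] [ChartedSpace H M] [IsManifold I ∞ M]

/-- The coordinate vector field `∂_i` of the chart at `c`. -/
def coordField (I : ModelWithCorners ℝ (Model n) H) {M : Type*} [TopologicalSpace M]
    [ChartedSpace H M] [IsManifold I ∞ M] (c : M) (i : Fin n) (y : M) : TangentSpace I y :=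
  (trivializationAt (Model n) (fun x : M => TangentSpace I x) c).symm y
    (EuclideanSpace.single i (1 : ℝ))

/-- The `i`-th component of the tangent vector `v` at `y`, in the chart at `c`. -/
def coord (I : ModelWithCorners ℝ (Model n) H) {M : Type*} [TopologicalSpace M]
    [ChartedSpace H M] [IsManifold I ∞ M] (c y : M) (v : TangentSpace I y) (i : Fin n) : ℝ :=
  (trivializationAt (Model n) (fun x : M => TangentSpace I x) c
    (Bundle.TotalSpace.mk' (Model n) y v)).2 i

/-- The partial derivative `∂_i f` at `y`, in the chart at `c`. -/
def partialDeriv (I : ModelWithCorners ℝ (Model n) H) {M : Type*} [TopologicalSpace M]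
    [ChartedSpace H M] [IsManifold I ∞ M] (c : M) (i : Fin n) (f : M → ℝ) (y : M) : ℝ :=
  mvfderiv I f y (coordField I c i y)

variable (D : InitialData I M)

/-- The matrix `g_ij` of the metric. -/
def gram (c y : M) : Matrix (Fin n) (Fin n) ℝ :=
  Matrix.of fun i j => D.g.inner y (coordField I c i y) (coordField I c j y)

/-- The components `p_ij`. -/
def pComp (c y : M) (i j : Fin n) : ℝ :=
  D.p y (coordField I c i y) (coordField I c j y)

/-- The Christoffel symbol `Γ^k_ij` of the Levi-Civita connection of `g`. -/
def christoffel (c : M) (k i j : Fin n) (y : M) : ℝ :=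
  (1 / 2) * ∑ l, (gram D c y)⁻¹ k l *
    (partialDeriv I c i (fun z => gram D c z j l) y
      + partialDeriv I c j (fun z => gram D c z i l) y
      - partialDeriv I c l (fun z => gram D c z i j) y)

/-- The components `R^l_ijk` of the curvature, `R(∂_i, ∂_j) ∂_k = R^l_ijk ∂_l`, with
`R(X, Y) = ∇_X ∇_Y - ∇_Y ∇_X - ∇_[X, Y]`. -/
def riemann (c : M) (l i j k : Fin n) (y : M) : ℝ :=
  partialDeriv I c i (christoffel D c l j k) y - partialDeriv I c j (christoffel D c l i k) y
    + ∑ m, (christoffel D c l i m y * christoffel D c m j k y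
      - christoffel D c l j m y * christoffel D c m i k y)

/-- The Levi-Civita covariant derivative `∇_v Y` of a vector field `Y` at `x`:
`∇_v Y = (v(Y^k) + Γ^k_ij v^i Y^j) ∂_k`. -/
def nabla (Y : ∀ y : M, TangentSpace I y) (x : M) (v : TangentSpace I x) : TangentSpace I x :=
  ∑ k, (mvfderiv I (fun y => coord I x y (Y y) k) x v
    + ∑ i, ∑ j, christoffel D x k i j x * coord I x x v i * coord I x x (Y x) j) •
      coordField I x k x

/-- The Lie derivative `L_X g`, as a bilinear form on the tangent space at `x`:
`(L_X g)_ij = X(g_ij) + g_kj ∂_i X^k + g_ik ∂_j X^k`. -/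
def lieMetric (X : ∀ y : M, TangentSpace I y) (x : M) (v w : TangentSpace I x) : ℝ :=
  ∑ i, ∑ j, coord I x x v i * coord I x x w j *
    (mvfderiv I (fun y => gram D x y i j) x (X x)
      + ∑ k, (gram D x x k j * partialDeriv I x i (fun y => coord I x y (X y) k) x
        + gram D x x i k * partialDeriv I x j (fun y => coord I x y (X y) k) x))

/-! ## Energy density and current density -/

/-- The scalar curvature `R_g = g^jk R^i_ijk`. -/
def scalarCurvature (x : M) : ℝ :=
  ∑ i, ∑ j, ∑ k, (gram D x x)⁻¹ j k * riemann D x i i j k x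

/-- The trace `tr_g p = g^ij p_ij`, computed in the chart at `c`. -/
def trP (c y : M) : ℝ := ∑ i, ∑ j, (gram D c y)⁻¹ i j * pComp D c y i j

/-- `|p|_g² = g^ik g^jl p_ij p_kl`. -/
def normSqP (x : M) : ℝ :=
  ∑ i, ∑ j, ∑ k, ∑ l, (gram D x x)⁻¹ i k * (gram D x x)⁻¹ j l *
    pComp D x x i j * pComp D x x k l

/-- The components `(div p)_j = g^ik ∇_i p_kj`. -/
def divP (x : M) (j : Fin n) : ℝ :=
  ∑ i, ∑ k, (gram D x x)⁻¹ i k *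
    (partialDeriv I x i (fun y => pComp D x y k j) x
      - ∑ l, (christoffel D x l i k x * pComp D x x l j
        + christoffel D x l i j x * pComp D x x k l))

/-- The energy density `μ = (R_g + (tr_g p)² - |p|_g²) / 2`. -/
def mu (x : M) : ℝ := (scalarCurvature D x + trP D x x ^ 2 - normSqP D x) / 2

/-- The components of the current density `J = div p - d (tr_g p)`. -/
def currentComp (x : M) (j : Fin n) : ℝ :=
  divP D x j - partialDeriv I x j (fun y => trP D x y) x

/-- The current density, as a 1-form. -/
def current (x : M) (v : TangentSpace I x) : ℝ := ∑ j, currentComp D x j * coord I x x v j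

/-- `|J|_g = (g^ij J_i J_j)^(1/2)`. -/
def currentNorm (x : M) : ℝ :=
  Real.sqrt (∑ i, ∑ j, (gram D x x)⁻¹ i j * currentComp D x i * currentComp D x j)

/-- The interior dominant energy condition `μ ≥ |J|`. -/
def InteriorDEC : Prop := ∀ x : M, currentNorm D x ≤ mu D x

end Coordinates

/-! ## Clifford algebras -/

/-- The quadratic form `v ↦ -|v|²` on `ℝⁿ`, so that `v · v = -|v|²` in its Clifford algebra. -/
def spaceForm (n : ℕ) : QuadraticForm ℝ (Model n) :=
  -(LinearMap.BilinMap.toQuadraticMap (innerₗ (Model n)))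

/-- The quadratic form `(t, v) ↦ t² - |v|²` on `ℝ × ℝⁿ`. -/
def spacetimeForm (n : ℕ) : QuadraticForm ℝ (ℝ × Model n) :=
  QuadraticMap.prod QuadraticMap.sq (spaceForm n)

/-- The inclusion of the Clifford algebra of space in the one of spacetime. -/
def cliffordIncl (n : ℕ) :
    CliffordAlgebra (spaceForm n) →ₐ[ℝ] CliffordAlgebra (spacetimeForm n) :=
  CliffordAlgebra.map (QuadraticMap.Isometry.inr QuadraticMap.sq (spaceForm n))

/-- A space of spacetime spinors: a finite-dimensional complex representation of the Clifford
algebra of `(ℝ × ℝⁿ, t² - |v|²)`, with a positive definite Hermitian inner product for which `e⁰` is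
symmetric and `e¹, …, eⁿ` are skew-symmetric. -/
structure SpinorModule (n : ℕ) (Δ : Type*) [NormedAddCommGroup Δ] [InnerProductSpace ℂ Δ]
    [FiniteDimensional ℂ Δ] where
  /-- Clifford multiplication -/
  ρ : CliffordAlgebra (spacetimeForm n) →ₐ[ℝ] Module.End ℂ Δ
  timelike : ∀ φ ψ : Δ,
    inner ℂ (ρ (CliffordAlgebra.ι _ ((1 : ℝ), (0 : Model n))) φ) ψ
      = inner ℂ φ (ρ (CliffordAlgebra.ι _ ((1 : ℝ), (0 : Model n))) ψ)
  spacelike : ∀ (v : Model n) (φ ψ : Δ),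
    inner ℂ (ρ (CliffordAlgebra.ι _ ((0 : ℝ), v)) φ) ψ
      = -inner ℂ φ (ρ (CliffordAlgebra.ι _ ((0 : ℝ), v)) ψ)

section SpinorAlgebra

variable {n : ℕ} {Δ : Type*} [NormedAddCommGroup Δ] [InnerProductSpace ℂ Δ]
  [FiniteDimensional ℂ Δ] (A : SpinorModule n Δ)

/-- Clifford multiplication by the future-directed unit timelike covector `e⁰`. -/
def e0 : Module.End ℂ Δ := A.ρ (CliffordAlgebra.ι _ ((1 : ℝ), (0 : Model n)))

/-- Clifford multiplication by the spacelike unit covector `eʲ`. -/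
def eS (j : Fin n) : Module.End ℂ Δ :=
  A.ρ (CliffordAlgebra.ι _ ((0 : ℝ), (EuclideanSpace.single j (1 : ℝ) : Model n)))

/-- The action of `Cl(ℝⁿ)`, in particular of the group `Spin(n)` in it, on spacetime spinors. -/
def spinRep : CliffordAlgebra (spaceForm n) →ₐ[ℝ] Module.End ℂ Δ := A.ρ.comp (cliffordIncl n)

/-- The indefinite Hermitian form `(φ, ψ) = ⟨e⁰ · φ, ψ⟩`. Since `e⁰ · e⁰ = 1`, it is the form with
`⟨φ, ψ⟩ = (e⁰ · φ, ψ)`. -/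
def indef (φ ψ : Δ) : ℂ := inner ℂ (e0 A φ) ψ

theorem e0_e0 (φ : Δ) : e0 A (e0 A φ) = φ := by
  have h : e0 A * e0 A = 1 := by
    have hq : spacetimeForm n ((1 : ℝ), (0 : Model n)) = 1 := by simp [spacetimeForm]
    rw [e0, ← map_mul A.ρ, CliffordAlgebra.ι_sq_scalar, hq, map_one, map_one]
  have := congrArg (fun f : Module.End ℂ Δ => f φ) h
  simpa using this

theorem e0_eS (j : Fin n) (φ : Δ) : e0 A (eS A j φ) = -eS A j (e0 A φ) := by
  have h : e0 A * eS A j + eS A j * e0 A = 0 := by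
    have hq : QuadraticMap.polar (spacetimeForm n) ((1 : ℝ), (0 : Model n))
        ((0 : ℝ), (EuclideanSpace.single j (1 : ℝ) : Model n)) = 0 := by
      simp [spacetimeForm, QuadraticMap.polar]
    rw [e0, eS, ← map_mul A.ρ, ← map_mul A.ρ, ← map_add A.ρ, CliffordAlgebra.ι_mul_ι_add_swap, hq,
      map_zero, map_zero]
  have := congrArg (fun f : Module.End ℂ Δ => f φ) h
  exact eq_neg_of_add_eq_zero_left (by simpa using this)

/-- The numbers `(eʲ · φ, φ)` are real. -/
theorem indef_eS_im (j : Fin n) (φ : Δ) : (indef A (eS A j φ) φ).im = 0 := by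
  have h : indef A (eS A j φ) φ = starRingEnd ℂ (indef A (eS A j φ) φ) := by
    unfold indef
    rw [inner_conj_symm]
    have h1 := A.timelike (eS A j φ) φ
    have h2 := A.spacelike (EuclideanSpace.single j (1 : ℝ)) φ (e0 A φ)
    change inner ℂ (e0 A (eS A j φ)) φ = inner ℂ (eS A j φ) (e0 A φ) at h1
    change inner ℂ (eS A j φ) (e0 A φ) = -inner ℂ φ (eS A j (e0 A φ)) at h2
    rw [h1, h2, e0_eS, inner_neg_right]
  exact Complex.conj_eq_iff_im.mp h.symm

end SpinorAlgebra

/-! ## Spin structures and spinor fields -/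

section Spin

variable {n : ℕ} {H : Type*} [TopologicalSpace H] {I : ModelWithCorners ℝ (Model n) H}
  {M : Type*} [TopologicalSpace M] [ChartedSpace H M] [IsManifold I ∞ M]

/-- The components `(g(w, e_1), …, g(w, e_n))` of `w` in an orthonormal frame `e` at `x`. -/
def frameCoord (D : InitialData I M) (x : M) (e : Fin n → TangentSpace I x)
    (w : TangentSpace I x) : Model n :=
  WithLp.toLp 2 fun i => D.g.inner x w (e i)

/-- A spin structure on `(M, g)`, given by a Čech cocycle: an open cover `U_a` with smooth
orthonormal frames `e_a`, and a smooth `Spin(n)`-valued cocycle `σ_ab` which lifts the changes of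
frame: `σ_ab · v_b · σ_ab⁻¹ = v_a` in the Clifford algebra, for the components `v_a`, `v_b` of a
tangent vector in the frames `e_a`, `e_b`. -/
structure SpinStructure (D : InitialData I M) (κ : Type*) where
  /-- the open cover -/
  U : κ → Set M
  isOpen_U : ∀ a, IsOpen (U a)
  /-- a member of the cover around each point -/
  indexAt : M → κ
  mem_U : ∀ x, x ∈ U (indexAt x)
  /-- the local orthonormal frames -/
  e : κ → Fin n → ∀ x : M, TangentSpace I x
  e_contMDiffOn : ∀ a i, ContMDiffOn I (I.prod 𝓘(ℝ, Model n)) ∞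
    (fun x => Bundle.TotalSpace.mk' (Model n) (E := fun x : M => TangentSpace I x) x (e a i x))
    (U a)
  e_orthonormal : ∀ a, ∀ x ∈ U a, ∀ i j, D.g.inner x (e a i x) (e a j x) = if i = j then 1 else 0
  /-- the transition functions -/
  σ : κ → κ → M → CliffordAlgebra (spaceForm n)
  σ_mem : ∀ a b, ∀ x ∈ U a ∩ U b, σ a b x ∈ spinGroup (spaceForm n)
  σ_contMDiffOn : ∀ (a b : κ) (f : CliffordAlgebra (spaceForm n) →ₗ[ℝ] ℝ),
    ContMDiffOn I 𝓘(ℝ, ℝ) ∞ (fun x => f (σ a b x)) (U a ∩ U b)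
  σ_lift : ∀ a b, ∀ x ∈ U a ∩ U b, ∀ w : TangentSpace I x,
    σ a b x * CliffordAlgebra.ι (spaceForm n) (frameCoord D x (fun i => e b i x) w)
      = CliffordAlgebra.ι (spaceForm n) (frameCoord D x (fun i => e a i x) w) * σ a b x
  σ_cocycle : ∀ a b c, ∀ x ∈ U a ∩ U b ∩ U c, σ a b x * σ b c x = σ a c x

variable {D : InitialData I M} {κ : Type*} {Δ : Type*} [NormedAddCommGroup Δ]
  [InnerProductSpace ℂ Δ] [FiniteDimensional ℂ Δ]

/-- A `C¹` section of the hypersurface spinor bundle, which is the vector bundle over `M` associated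
to the spin structure with fibre the spacetime spinors: its components `φ_a` in the frames `e_a`
satisfy `φ_a = σ_ab φ_b`. The values of `φ_a` outside of `U_a` are irrelevant. -/
structure Spinor (S : SpinStructure D κ) (A : SpinorModule n Δ) where
  /-- the components in the local frames -/
  rep : κ → M → Δ
  transition : ∀ a b, ∀ x ∈ S.U a ∩ S.U b, rep a x = spinRep A (S.σ a b x) (rep b x)
  contMDiffOn : ∀ a, ContMDiffOn I 𝓘(ℝ, Δ) 1 (rep a) (S.U a)

variable {S : SpinStructure D κ} {A : SpinorModule n Δ} (φ : Spinor S A)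

/-- The Levi-Civita spin connection of `g`, in the frame `e_a`:
`∇_v φ = dφ(v) + (1/4) ∑ g(∇_v e_i, e_j) eⁱ · eʲ · φ`. -/
def spinNabla (a : κ) (x : M) (v : TangentSpace I x) : Δ :=
  mvfderiv I (φ.rep a) x v +
    (1 / 4 : ℝ) • ∑ i, ∑ j, (D.g.inner x (nabla D (S.e a i) x v) (S.e a j x)) •
      eS A i (eS A j (φ.rep a x))

/-- The spacetime spin connection along `M`, in the frame `e_a`:
`∇̃_v φ = ∇_v φ - (1/2) ∑ p(v, e_j) eʲ · e⁰ · φ`. -/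
def spacetimeNabla (a : κ) (x : M) (v : TangentSpace I x) : Δ :=
  spinNabla φ a x v - (1 / 2 : ℝ) • ∑ j, (D.p x v (S.e a j x)) • eS A j (e0 A (φ.rep a x))

/-- `φ` is parallel for the spacetime spin connection: `∇̃φ = 0`. -/
def IsParallel : Prop :=
  ∀ (a : κ), ∀ x ∈ S.U a, ∀ v : TangentSpace I x, spacetimeNabla φ a x v = 0

/-- `N = ⟨φ, φ⟩`. -/
def lapse (x : M) : ℝ :=
  (inner ℂ (φ.rep (S.indexAt x) x) (φ.rep (S.indexAt x) x)).re

/-- `X = ∑ (eʲ · φ, φ) e_j`. -/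
def shift (x : M) : TangentSpace I x :=
  ∑ j, (indef A (eS A j (φ.rep (S.indexAt x) x)) (φ.rep (S.indexAt x) x)).re •
    S.e (S.indexAt x) j x

/-- `(μ - J · e⁰ ·) φ`, in the frame `e_a`, where `J · = ∑ J(e_i) eⁱ ·`. -/
def energyMomentum (a : κ) (x : M) : Δ :=
  mu D x • φ.rep a x - ∑ i, current D x (S.e a i x) • eS A i (e0 A (φ.rep a x))

/-- `Re ⟨(μ - J · e⁰ ·) φ, φ⟩ = 0` on `M`. -/
def VanishingConstraint : Prop :=
  ∀ (a : κ), ∀ x ∈ S.U a, (inner ℂ (energyMomentum φ a x) (φ.rep a x)).re = 0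

end Spin

end InitialDataSpin

end

open scoped Manifold ContDiff Bundle

noncomputable section

namespace InitialDataSpin


/-! Both N and the components X^j are real quadratic functions Re ⟨Tψ, ψ⟩ of the local
representative ψ of the spinor, with T = 1 and T = e⁰eʲ. Everything reduces to pointwise Clifford
algebra in one orthonormal frame, once N and X are known not to depend on the frame. They do not,
because a spin group element acts unitarily and, being even, commutes with e⁰ (`lapse_eq`,
`shift_eq`).

For (i), let θ_ij = g(∇_v e_i, e_j), which is antisymmetric. The equation of a parallel spinor reads
dψ(v) = ½ Σ p(v, e_j) eʲe⁰ψ − ¼ Σ θ_ij eⁱeʲψ. Differentiating the quadratic functions gives dN(v) =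
−p(v, X) and dXᵏ(v) = Σ θ_kj Xʲ − N p(v, e_k) (`two_mul_re_inner_parallelRhs`,
`re_inner_e0_eS_parallelRhs`). The θ terms cancel against the derivatives of the frame, so g(∇_v X,
w) = −N p(v, w) (`inner_nabla_shift_of_isParallel`). Since L_X g is the symmetrization of ∇X
(`lieMetric_eq`), it equals −2Np. Moreover N² and |X|² have the same differential, namely −2N p(v,
X).

For (ii), Re ⟨eʲe⁰φ, φ⟩ = −Xʲ turns the constraint into μN + J(X) = 0. Clifford multiplication by v
has norm |v|, so Cauchy–Schwarz gives |X| ≤ N. With |J| ≤ μ this is the equality case of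
Cauchy–Schwarz, and |μX + NJ|² ≤ 0 (`mul_add_mul_eq_zero_of_sum_sq_le`). -/

theorem inner_real_smul_left {Δ : Type*} [NormedAddCommGroup Δ] [InnerProductSpace ℂ Δ]
    (r : ℝ) (φ ψ : Δ) : inner ℂ (r • φ) ψ = r • inner ℂ φ ψ := by
  rw [RCLike.real_smul_eq_coe_smul (K := ℂ), inner_smul_left]
  simp

theorem inner_real_smul_right {Δ : Type*} [NormedAddCommGroup Δ] [InnerProductSpace ℂ Δ]
    (r : ℝ) (φ ψ : Δ) : inner ℂ φ (r • ψ) = r • inner ℂ φ ψ := by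
  rw [RCLike.real_smul_eq_coe_smul (K := ℂ), inner_smul_right]
  simp

/-! ### Pointwise Clifford algebra on the spinor module -/

section SpinorAlgebra

variable {n : ℕ} {Δ : Type*} [NormedAddCommGroup Δ] [InnerProductSpace ℂ Δ]
  [FiniteDimensional ℂ Δ] (A : SpinorModule n Δ)

theorem spinRep_ι (v : Model n) :
    spinRep A (CliffordAlgebra.ι _ v) = A.ρ (CliffordAlgebra.ι _ ((0 : ℝ), v)) :=
  congrArg A.ρ (CliffordAlgebra.map_apply_ι _ v)

theorem spinRep_ι_single (j : Fin n) :
    spinRep A (CliffordAlgebra.ι _ (EuclideanSpace.single j (1 : ℝ))) = eS A j :=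
  spinRep_ι A _

theorem spinRep_ι_eq_sum (v : Model n) :
    spinRep A (CliffordAlgebra.ι _ v) = ∑ j, v j • eS A j := by
  have hv : v = ∑ j, v j • (EuclideanSpace.single j (1 : ℝ) : Model n) := by
    ext k
    simp [Finset.sum_apply, Pi.single_apply]
  conv_lhs => rw [hv]
  simp only [map_sum, map_smul, spinRep_ι_single]

theorem e0_mul_spinRep_ι (v : Model n) :
    e0 A * spinRep A (CliffordAlgebra.ι _ v) = -(spinRep A (CliffordAlgebra.ι _ v) * e0 A) := by
  ext φ
  rw [spinRep_ι_eq_sum]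
  simp [e0_eS, LinearMap.sum_apply]

/-- Since e⁰ anticommutes with each spatial vector, moving it across a product costs one sign per
factor, which is the grade involution. Even elements therefore commute with e⁰. -/
theorem e0_mul_spinRep (s : CliffordAlgebra (spaceForm n)) :
    e0 A * spinRep A s = spinRep A (CliffordAlgebra.involute s) * e0 A := by
  induction s using CliffordAlgebra.induction with
  | algebraMap r => simpa using (Algebra.commutes r (e0 A)).symm
  | ι v => simp [e0_mul_spinRep_ι]
  | mul a b ha hb => rw [map_mul, map_mul, map_mul, ← mul_assoc, ha, mul_assoc, hb, mul_assoc]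
  | add a b ha hb => simp only [map_add, mul_add, add_mul, ha, hb]

theorem inner_e0_left (φ ψ : Δ) : inner ℂ (e0 A φ) ψ = inner ℂ φ (e0 A ψ) := A.timelike φ ψ

theorem inner_eS_left (j : Fin n) (φ ψ : Δ) :
    inner ℂ (eS A j φ) ψ = -inner ℂ φ (eS A j ψ) := A.spacelike _ φ ψ

/-- The Clifford `star` reverses products and negates vectors, exactly as the adjoint does because
vectors act skew-symmetrically. -/
theorem inner_spinRep_left (s : CliffordAlgebra (spaceForm n)) (φ ψ : Δ) :
    inner ℂ (spinRep A s φ) ψ = inner ℂ φ (spinRep A (star s) ψ) := by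
  induction s using CliffordAlgebra.induction generalizing φ ψ with
  | algebraMap r =>
    simp only [CliffordAlgebra.star_algebraMap, AlgHom.commutes, Module.algebraMap_end_apply,
      inner_real_smul_left, inner_real_smul_right]
  | ι v =>
    rw [CliffordAlgebra.star_ι, map_neg, spinRep_ι]
    simpa using A.spacelike v φ ψ
  | mul a b ha hb => simp only [map_mul, star_mul, Module.End.mul_apply, ha, hb]
  | add a b ha hb =>
    simp only [map_add, star_add, LinearMap.add_apply, inner_add_left, inner_add_right, ha, hb]

theorem inner_spinRep_of_mem_spinGroup {s : CliffordAlgebra (spaceForm n)}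
    (hs : s ∈ spinGroup (spaceForm n)) (φ ψ : Δ) :
    inner ℂ (spinRep A s φ) (spinRep A s ψ) = inner ℂ φ ψ := by
  rw [inner_spinRep_left, ← Module.End.mul_apply, ← map_mul, spinGroup.star_mul_self_of_mem hs,
    map_one, Module.End.one_apply]

theorem eS_eS (i j : Fin n) (φ : Δ) :
    eS A i (eS A j φ) = -eS A j (eS A i φ) - (if i = j then (2 : ℝ) else 0) • φ := by
  have h : eS A i * eS A j + eS A j * eS A i
      = -algebraMap ℝ (Module.End ℂ Δ) (if i = j then (2 : ℝ) else 0) := by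
    have hq : QuadraticMap.polar (spaceForm n) (EuclideanSpace.single i (1 : ℝ) : Model n)
        (EuclideanSpace.single j (1 : ℝ) : Model n) = -(if i = j then (2 : ℝ) else 0) := by
      have := real_inner_comm (EuclideanSpace.single i (1 : ℝ) : Model n)
        (EuclideanSpace.single j (1 : ℝ) : Model n)
      simp only [spaceForm, QuadraticMap.polar, neg_apply,
        LinearMap.BilinMap.toQuadraticMap_apply, innerₗ_apply_apply, inner_add_left,
        inner_add_right, this]
      rw [EuclideanSpace.inner_single_left]
      by_cases hij : i = j <;> (simp [hij, inner]; try norm_num)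
    rw [← spinRep_ι_single, ← spinRep_ι_single, ← map_mul (spinRep A), ← map_mul (spinRep A),
      ← map_add, CliffordAlgebra.ι_mul_ι_add_swap, hq, map_neg, map_neg, AlgHom.commutes]
  have h' := congrArg (fun f : Module.End ℂ Δ => f φ) h
  simp only [LinearMap.add_apply, Module.End.mul_apply, LinearMap.neg_apply,
    Module.algebraMap_end_apply] at h'
  rw [eq_sub_iff_add_eq, ← sub_eq_zero]
  rw [← sub_eq_zero] at h'
  rw [← h']
  abel

/-- The components `(eʲ · ψ, ψ)` of the vector of a spinor `ψ`. -/
def spinorVector (ψ : Δ) (j : Fin n) : ℝ := (indef A (eS A j ψ) ψ).re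

/-- The pairing of v with X as a single matrix element of e⁰v. This form serves both the
Cauchy–Schwarz bound and the change of frame. -/
theorem sum_mul_spinorVector (v : Model n) (ψ : Δ) :
    ∑ j, v j * spinorVector A ψ j
      = (inner ℂ (e0 A (spinRep A (CliffordAlgebra.ι _ v) ψ)) ψ).re := by
  rw [spinRep_ι_eq_sum]
  simp [spinorVector, indef, LinearMap.sum_apply, map_sum]

theorem norm_e0 (ψ : Δ) : ‖e0 A ψ‖ = ‖ψ‖ := by
  have h : inner ℂ (e0 A ψ) (e0 A ψ) = inner ℂ ψ ψ := by rw [inner_e0_left, e0_e0]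
  rw [inner_self_eq_norm_sq_to_K, inner_self_eq_norm_sq_to_K] at h
  exact (sq_eq_sq₀ (norm_nonneg _) (norm_nonneg _)).1 (by exact_mod_cast h)

theorem norm_spinRep_ι (v : Model n) (ψ : Δ) :
    ‖spinRep A (CliffordAlgebra.ι _ v) ψ‖ = ‖v‖ * ‖ψ‖ := by
  have h : inner ℂ (spinRep A (CliffordAlgebra.ι _ v) ψ) (spinRep A (CliffordAlgebra.ι _ v) ψ)
      = ((‖v‖ ^ 2 : ℝ) : ℂ) * inner ℂ ψ ψ := by
    have hq : spaceForm n v = -‖v‖ ^ 2 := by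
      simp [spaceForm]
    rw [inner_spinRep_left, ← Module.End.mul_apply, ← map_mul, CliffordAlgebra.star_ι, neg_mul,
      CliffordAlgebra.ι_sq_scalar, hq, ← map_neg, neg_neg, AlgHom.commutes,
      Module.algebraMap_end_apply, RCLike.real_smul_eq_coe_smul (K := ℂ), inner_smul_right]
    rfl
  rw [inner_self_eq_norm_sq_to_K, inner_self_eq_norm_sq_to_K] at h
  refine (sq_eq_sq₀ (norm_nonneg _) (by positivity)).1 ?_
  rw [mul_pow]
  exact Complex.ofReal_injective (by push_cast at h ⊢; exact h)

theorem sum_mul_spinorVector_le (v : Model n) (ψ : Δ) :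
    ∑ j, v j * spinorVector A ψ j ≤ ‖v‖ * ‖ψ‖ ^ 2 := by
  rw [sum_mul_spinorVector]
  refine ((le_abs_self _).trans (Complex.abs_re_le_norm _)).trans
    ((norm_inner_le_norm _ _).trans ?_)
  rw [norm_e0, norm_spinRep_ι, sq, mul_assoc]

theorem sum_spinorVector_sq_le (ψ : Δ) : ∑ j, spinorVector A ψ j ^ 2 ≤ (‖ψ‖ ^ 2) ^ 2 := by
  -- Testing the bound on v = X itself gives |X|² ≤ |X| ‖ψ‖².
  have h := sum_mul_spinorVector_le A (WithLp.toLp 2 (spinorVector A ψ)) ψ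
  have hn := EuclideanSpace.norm_sq_eq (WithLp.toLp 2 (spinorVector A ψ))
  simp only [Real.norm_eq_abs, sq_abs] at hn
  rw [← hn]
  have h' : ‖(WithLp.toLp 2 (spinorVector A ψ) : Model n)‖ ^ 2
      ≤ ‖(WithLp.toLp 2 (spinorVector A ψ) : Model n)‖ * ‖ψ‖ ^ 2 := by
    rw [hn]
    simpa [sq] using h
  generalize ‖(WithLp.toLp 2 (spinorVector A ψ) : Model n)‖ = a at *
  -- From a² ≤ aN and (a − N)² ≥ 0 one gets N² ≥ 2aN − a² ≥ a², without dividing by a.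
  nlinarith [sq_nonneg (‖ψ‖), sq_nonneg (a - ‖ψ‖ ^ 2)]

/-- The components of `e⁰ eᵏ eⁱ eʲ` in a spinor state. -/
theorem re_inner_e0_eS_eS_eS (k i j : Fin n) (ψ : Δ) :
    (inner ℂ (e0 A (eS A k (eS A i (eS A j ψ)))) ψ).re
      = (if j = k then spinorVector A ψ i else 0) - (if i = k then spinorVector A ψ j else 0)
        - (if j = i then spinorVector A ψ k else 0) := by
  set T : Fin n → Fin n → Fin n → ℝ :=
    fun k i j => (inner ℂ (e0 A (eS A k (eS A i (eS A j ψ)))) ψ).re with hT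
  -- The adjoint of e⁰eᵏeⁱeʲ is −eʲeⁱeᵏe⁰ = e⁰eʲeⁱeᵏ. Reversal of three distinct indices is odd, so
  -- this symmetry kills the totally antisymmetric part.
  have hsymm : ∀ k i j, T k i j = T j i k := by
    intro k i j
    have : inner ℂ (e0 A (eS A k (eS A i (eS A j ψ)))) ψ
        = inner ℂ ψ (e0 A (eS A j (eS A i (eS A k ψ)))) := by
      rw [inner_e0_left, inner_eS_left, inner_eS_left, inner_eS_left]
      simp only [e0_eS, map_neg, inner_neg_right, neg_neg]
    simp only [hT, this]
    exact inner_re_symm (𝕜 := ℂ) _ _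
  have h1 : ∀ k i j, T k i j = -T i k j - (if k = i then 2 * spinorVector A ψ j else 0) := by
    intro k i j
    simp only [hT, eS_eS A k i (eS A j ψ)]
    split_ifs <;>
      simp [spinorVector, indef]
  have h2 : ∀ k i j, T k i j = -T k j i - (if i = j then 2 * spinorVector A ψ k else 0) := by
    intro k i j
    simp only [hT, eS_eS A i j ψ]
    split_ifs <;>
      simp [spinorVector, indef]
  change T k i j = _
  -- One reversal followed by three adjacent swaps returns T k i j with the opposite sign, up to
  -- Kronecker terms, which determines it.
  have a1 := hsymm k i j
  have a2 := h1 j i k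
  have a3 := h2 i j k
  have a4 := h1 i k j
  split_ifs at * <;> linarith

/-- With ws = sv, the element e⁰ws equals e⁰sv = se⁰v because s is even, and unitarity removes s
from both slots. -/
theorem sum_mul_spinorVector_of_mem_spinGroup {s : CliffordAlgebra (spaceForm n)}
    (hs : s ∈ spinGroup (spaceForm n)) {v w : Model n}
    (h : s * CliffordAlgebra.ι (spaceForm n) v = CliffordAlgebra.ι (spaceForm n) w * s) (ψ : Δ) :
    ∑ j, w j * spinorVector A (spinRep A s ψ) j = ∑ j, v j * spinorVector A ψ j := by
  have he : ∀ χ, e0 A (spinRep A s χ) = spinRep A s (e0 A χ) := by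
    intro χ
    have := congrArg (fun f : Module.End ℂ Δ => f χ) (e0_mul_spinRep A s)
    simpa [spinGroup.involute_eq hs] using this
  rw [sum_mul_spinorVector, sum_mul_spinorVector, ← Module.End.mul_apply (spinRep A _), ← map_mul, ← h,
    map_mul, Module.End.mul_apply, he, inner_spinRep_of_mem_spinGroup A hs]

/-- For i ≠ j the product eⁱeʲ is skew-adjoint, so its expectation is imaginary; for i = j it is −1.
-/
theorem re_inner_eS_eS (i j : Fin n) (ψ : Δ) :
    (inner ℂ (eS A i (eS A j ψ)) ψ).re = if i = j then -‖ψ‖ ^ 2 else 0 := by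
  have h1 : (inner ℂ (eS A i (eS A j ψ)) ψ).re = (inner ℂ (eS A j (eS A i ψ)) ψ).re := by
    rw [inner_eS_left, inner_eS_left A j (eS A i ψ)]
    exact congrArg Neg.neg (inner_re_symm (𝕜 := ℂ) _ _)
  have h2 : (inner ℂ (eS A i (eS A j ψ)) ψ).re
      = -(inner ℂ (eS A j (eS A i ψ)) ψ).re - (if i = j then 2 * ‖ψ‖ ^ 2 else 0) := by
    rw [eS_eS A i j ψ]
    have hN : (inner ℂ ψ ψ).re = ‖ψ‖ ^ 2 := inner_self_eq_norm_sq (𝕜 := ℂ) ψ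
    rw [inner_sub_left, inner_neg_left, inner_real_smul_left, Complex.sub_re, Complex.neg_re,
      Complex.smul_re, hN]
    split_ifs <;> simp
  split_ifs at * <;> linarith

theorem re_inner_eS_e0 (j : Fin n) (ψ : Δ) :
    (inner ℂ (eS A j (e0 A ψ)) ψ).re = -spinorVector A ψ j := by
  simp [spinorVector, indef, e0_eS]

/-- The right hand side of the equation `dψ = …` of a parallel spinor, for the connection form `θ`
and the covector `q = p(v, ·)`. -/
def parallelRhs (θ : Fin n → Fin n → ℝ) (q : Fin n → ℝ) (ψ : Δ) : Δ :=
  (1 / 2 : ℝ) • ∑ j, q j • eS A j (e0 A ψ)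
    - (1 / 4 : ℝ) • ∑ i, ∑ j, θ i j • eS A i (eS A j ψ)

/-- The connection term contributes only through the diagonal of θ, which vanishes: spin rotations
preserve the norm. -/
theorem two_mul_re_inner_parallelRhs {θ : Fin n → Fin n → ℝ}
    (hθ : ∀ i j, θ i j = -θ j i) (q : Fin n → ℝ) (ψ : Δ) :
    2 * (inner ℂ (parallelRhs A θ q ψ) ψ).re = -∑ j, q j * spinorVector A ψ j := by
  have hdiag : ∀ i, θ i i = 0 := fun i => by linarith [hθ i i]
  simp only [parallelRhs, inner_sub_left, inner_real_smul_left, sum_inner, Complex.sub_re,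
    Complex.smul_re, Complex.re_sum, re_inner_eS_eS, re_inner_eS_e0, smul_eq_mul]
  simp [hdiag]

theorem re_inner_e0_eS_parallelRhs {θ : Fin n → Fin n → ℝ}
    (hθ : ∀ i j, θ i j = -θ j i) (q : Fin n → ℝ) (k : Fin n) (ψ : Δ) :
    (inner ℂ (e0 A (eS A k (parallelRhs A θ q ψ))) ψ).re
      + (inner ℂ (e0 A (eS A k ψ)) (parallelRhs A θ q ψ)).re
      = ∑ j, θ k j * spinorVector A ψ j - q k * ‖ψ‖ ^ 2 := by
  have hdiag : ∀ i, θ i i = 0 := fun i => by linarith [hθ i i]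
  -- The operator e⁰eᵏ is self-adjoint, so the two Leibniz terms coincide.
  have hs : ∀ χ, (inner ℂ (e0 A (eS A k ψ)) χ).re = (inner ℂ (e0 A (eS A k χ)) ψ).re := by
    intro χ
    rw [inner_e0_left, inner_eS_left, ← inner_neg_right, ← e0_eS]
    exact inner_re_symm (𝕜 := ℂ) _ _
  have h0 : ∀ j, e0 A (eS A k (eS A j (e0 A ψ))) = eS A k (eS A j ψ) := by
    intro j
    simp [e0_eS, e0_e0]
  rw [hs, ← two_mul]
  simp only [parallelRhs, map_sub, map_sum, LinearMap.map_smul_of_tower, inner_sub_left,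
    inner_real_smul_left, sum_inner, Complex.sub_re, Complex.smul_re, Complex.re_sum,
    re_inner_e0_eS_eS_eS, re_inner_eS_eS, h0, smul_eq_mul, mul_sub, Finset.sum_sub_distrib,
    mul_ite, mul_zero, Finset.sum_ite_eq, Finset.sum_ite_eq', Finset.mem_univ, if_true, hdiag,
    zero_mul]
  have h3 : ∑ i, ∑ j, (if i = k then θ i j * spinorVector A ψ j else 0)
      = ∑ j, θ k j * spinorVector A ψ j := by
    rw [Finset.sum_comm]
    simp
  have h4 : ∑ i, θ i k * spinorVector A ψ i = -∑ j, θ k j * spinorVector A ψ j := by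
    rw [← Finset.sum_neg_distrib]
    exact Finset.sum_congr rfl fun i _ => by rw [hθ i k]; ring
  rw [h3, h4]
  simp
  ring

end SpinorAlgebra


/-! ### Derivatives of vector-valued functions on a manifold -/

section ScalarFunctions

variable {E H M : Type*} [NormedAddCommGroup E] [NormedSpace ℝ E] [TopologicalSpace H]
  {I : ModelWithCorners ℝ E H} [TopologicalSpace M] [ChartedSpace H M] {x : M}

theorem mvfderiv_congr {F : Type*} [NormedAddCommGroup F] [NormedSpace ℝ F] {f g : M → F}
    (h : f =ᶠ[nhds x] g) : mvfderiv I f x = mvfderiv I g x := by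
  simp only [mvfderiv, h.mfderiv_eq]
  rfl

theorem mdifferentiableAt_finset_sum {ι F : Type*} [NormedAddCommGroup F] [NormedSpace ℝ F]
    (s : Finset ι) {f : ι → M → F}
    (hf : ∀ i ∈ s, MDifferentiableAt I 𝓘(ℝ, F) (f i) x) :
    MDifferentiableAt I 𝓘(ℝ, F) (fun y => ∑ i ∈ s, f i y) x := by
  classical
  induction s using Finset.induction_on with
  | empty => simpa using mdifferentiableAt_const
  | insert a s ha ih =>
    simp only [Finset.sum_insert ha]
    exact (hf a (by simp)).add (ih fun i hi => hf i (by simp [hi]))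

theorem mvfderiv_finset_sum {ι F : Type*} [NormedAddCommGroup F] [NormedSpace ℝ F]
    (s : Finset ι) {f : ι → M → F}
    (hf : ∀ i ∈ s, MDifferentiableAt I 𝓘(ℝ, F) (f i) x) :
    mvfderiv I (fun y => ∑ i ∈ s, f i y) x = ∑ i ∈ s, mvfderiv I (f i) x := by
  classical
  induction s using Finset.induction_on with
  | empty => simpa using mvfderiv_const (0 : F)
  | insert a s ha ih =>
    simp only [Finset.sum_insert ha]
    rw [mvfderiv_fun_add (hf a (by simp))
      (mdifferentiableAt_finset_sum s fun i hi => hf i (by simp [hi])),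
      ih fun i hi => hf i (by simp [hi])]

theorem mdifferentiableAt_fun_mul {f g : M → ℝ} (hf : MDifferentiableAt I 𝓘(ℝ, ℝ) f x)
    (hg : MDifferentiableAt I 𝓘(ℝ, ℝ) g x) :
    MDifferentiableAt I 𝓘(ℝ, ℝ) (fun y => f y * g y) x :=
  hf.mul hg

theorem mvfderiv_fun_mul_apply {f g : M → ℝ} (hf : MDifferentiableAt I 𝓘(ℝ, ℝ) f x)
    (hg : MDifferentiableAt I 𝓘(ℝ, ℝ) g x) (v : TangentSpace I x) :
    mvfderiv I (fun y => f y * g y) x v = f x * mvfderiv I g x v + g x * mvfderiv I f x v := by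
  rw [mvfderiv_fun_mul hf hg]
  rfl

/-- The chain rule for a function of a vector-valued function. -/
theorem mvfderiv_comp_hasFDerivAt {F G : Type*} [NormedAddCommGroup F] [NormedSpace ℝ F]
    [NormedAddCommGroup G] [NormedSpace ℝ G] {f : M → F} {h : F → G} {h' : F →L[ℝ] G}
    (hh : HasFDerivAt h h' (f x)) (hf : MDifferentiableAt I 𝓘(ℝ, F) f x) (v : TangentSpace I x) :
    mvfderiv I (fun y => h (f y)) x v = h' (mvfderiv I f x v) := by
  have := (hh.hasMFDerivAt.comp x hf.hasMFDerivAt).mfderiv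
  change mfderiv I 𝓘(ℝ, G) (h ∘ f) x v = _
  rw [this]
  rfl

end ScalarFunctions

/-! ### Levi-Civita calculus in the coordinates of a chart -/

section Coordinates

variable {n : ℕ} {H : Type*} [TopologicalSpace H] {I : ModelWithCorners ℝ (Model n) H}
  {M : Type*} [TopologicalSpace M] [ChartedSpace H M] [IsManifold I ∞ M]

theorem coord_eq_linearMapAt {c y : M}
    (hy : y ∈ (trivializationAt (Model n) (fun x : M => TangentSpace I x) c).baseSet)
    (v : TangentSpace I y) (i : Fin n) :
    coord I c y v i = (trivializationAt (Model n) (fun x : M => TangentSpace I x) c).linearMapAt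
      ℝ y v i := by
  rw [Bundle.Trivialization.coe_linearMapAt_of_mem _ hy]
  rfl

/-- The `i`-th component in the chart at `c`, as a linear form. -/
def coordLin (I : ModelWithCorners ℝ (Model n) H) {M : Type*} [TopologicalSpace M]
    [ChartedSpace H M] [IsManifold I ∞ M] (c y : M) (i : Fin n) : TangentSpace I y →ₗ[ℝ] ℝ :=
  (EuclideanSpace.proj i : Model n →L[ℝ] ℝ).toLinearMap.comp
    ((trivializationAt (Model n) (fun x : M => TangentSpace I x) c).linearMapAt ℝ y)

/-- Over the base set this makes `coord` visibly linear, so that `map_sum` and `map_smul` apply to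
components. -/
theorem coord_eq_coordLin {c y : M}
    (hy : y ∈ (trivializationAt (Model n) (fun x : M => TangentSpace I x) c).baseSet)
    (v : TangentSpace I y) (i : Fin n) : coord I c y v i = coordLin I c y i v :=
  coord_eq_linearMapAt hy v i

theorem mem_baseSet_self (x : M) :
    x ∈ (trivializationAt (Model n) (fun x : M => TangentSpace I x) x).baseSet :=
  FiberBundle.mem_baseSet_trivializationAt (Model n) (fun x : M => TangentSpace I x) x

theorem coord_self_eq_coordLin (x : M) (v : TangentSpace I x) (i : Fin n) :
    coord I x x v i = coordLin I x x i v :=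
  coord_eq_coordLin (mem_baseSet_self x) v i

theorem coord_coordField {c y : M}
    (hy : y ∈ (trivializationAt (Model n) (fun x : M => TangentSpace I x) c).baseSet)
    (i k : Fin n) : coord I c y (coordField I c i y) k = if k = i then 1 else 0 := by
  unfold coord coordField
  rw [Bundle.Trivialization.apply_mk_symm _ hy]
  simp

theorem sum_coord_smul_coordField {c y : M}
    (hy : y ∈ (trivializationAt (Model n) (fun x : M => TangentSpace I x) c).baseSet)
    (v : TangentSpace I y) : ∑ i, coord I c y v i • coordField I c i y = v := by
  set e := trivializationAt (Model n) (fun x : M => TangentSpace I x) c with he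
  have h1 : ∀ i, coordField I c i y = e.symmₗ ℝ y (EuclideanSpace.single i (1 : ℝ)) :=
    fun i => (e.symmₗ_apply hy _).symm
  simp only [h1, ← map_smul, ← map_sum]
  have h2 : ∑ i, coord I c y v i • (EuclideanSpace.single i (1 : ℝ) : Model n)
      = e.linearMapAt ℝ y v := by
    ext k
    simp [coord_eq_linearMapAt hy, Finset.sum_apply, Pi.single_apply, he]
  rw [h2, e.symmₗ_linearMapAt hy]

theorem eq_of_coord_eq {x : M} {v w : TangentSpace I x}
    (h : ∀ k, coord I x x v k = coord I x x w k) : v = w := by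
  rw [← sum_coord_smul_coordField (mem_baseSet_self x) v,
    ← sum_coord_smul_coordField (mem_baseSet_self x) w]
  simp only [h]

theorem eventually_mem_baseSet (x : M) : ∀ᶠ y in nhds x,
    y ∈ (trivializationAt (Model n) (fun x : M => TangentSpace I x) x).baseSet :=
  (trivializationAt (Model n) (fun x : M => TangentSpace I x) x).open_baseSet.mem_nhds
    (mem_baseSet_self x)

theorem mdifferentiableAt_coord {Y : ∀ y : M, TangentSpace I y} {x : M}
    (hY : MDifferentiableAt I (I.prod 𝓘(ℝ, Model n))
      (fun y => Bundle.TotalSpace.mk' (Model n) (E := fun x : M => TangentSpace I x) y (Y y)) x)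
    (k : Fin n) : MDifferentiableAt I 𝓘(ℝ, ℝ) (fun y => coord I x y (Y y) k) x := by
  have h := (mdifferentiableAt_section (F := Model n) (IB := I)
    (E := fun x : M => TangentSpace I x) Y).1 hY
  exact ((EuclideanSpace.proj k : Model n →L[ℝ] ℝ).differentiableAt.mdifferentiableAt).comp x h

theorem mdifferentiableAt_coordField (x : M) (i : Fin n) :
    MDifferentiableAt I (I.prod 𝓘(ℝ, Model n))
      (fun y => Bundle.TotalSpace.mk' (Model n) (E := fun x : M => TangentSpace I x) y
        (coordField I x i y)) x := by
  refine (mdifferentiableAt_section (F := Model n) (IB := I)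
    (E := fun x : M => TangentSpace I x) _).2 ?_
  refine (mdifferentiableAt_const (c := EuclideanSpace.single i (1 : ℝ))).congr_of_eventuallyEq ?_
  filter_upwards [eventually_mem_baseSet (I := I) x] with y hy
  unfold coordField
  exact congrArg Prod.snd (Bundle.Trivialization.apply_mk_symm _ hy _)

variable (D : InitialData I M)

theorem mdifferentiableAt_inner {Y Z : ∀ y : M, TangentSpace I y} {x : M}
    (hY : MDifferentiableAt I (I.prod 𝓘(ℝ, Model n))
      (fun y => Bundle.TotalSpace.mk' (Model n) (E := fun x : M => TangentSpace I x) y (Y y)) x)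
    (hZ : MDifferentiableAt I (I.prod 𝓘(ℝ, Model n))
      (fun y => Bundle.TotalSpace.mk' (Model n) (E := fun x : M => TangentSpace I x) y (Z y)) x) :
    MDifferentiableAt I 𝓘(ℝ, ℝ) (fun y => D.g.inner y (Y y) (Z y)) x := by
  have h := MDifferentiableAt.clm_bundle_apply₂ (F₁ := Model n) (F₂ := Model n) (F₃ := ℝ)
    (E₁ := fun x : M => TangentSpace I x) (E₂ := fun x : M => TangentSpace I x)
    (E₃ := Bundle.Trivial M ℝ) (b := id)
    ((D.g.contMDiff.contMDiffAt (x := x)).mdifferentiableAt (by simp)) hY hZ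
  exact (mdifferentiableAt_section (F := ℝ) (IB := I) (E := Bundle.Trivial M ℝ) _).1 h

theorem mdifferentiableAt_gram (x : M) (i j : Fin n) :
    MDifferentiableAt I 𝓘(ℝ, ℝ) (fun y => gram D x y i j) x :=
  mdifferentiableAt_inner D (mdifferentiableAt_coordField x i) (mdifferentiableAt_coordField x j)

theorem gram_symm (c y : M) (i j : Fin n) : gram D c y i j = gram D c y j i := D.g.symm y _ _

theorem inner_eq_sum_gram {c y : M}
    (hy : y ∈ (trivializationAt (Model n) (fun x : M => TangentSpace I x) c).baseSet)
    (v w : TangentSpace I y) :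
    D.g.inner y v w = ∑ i, ∑ j, gram D c y i j * coord I c y v i * coord I c y w j := by
  conv_lhs => rw [← sum_coord_smul_coordField hy v, ← sum_coord_smul_coordField hy w]
  simp only [map_sum, sum_apply, map_smul, smul_apply,
    smul_eq_mul, Finset.mul_sum]
  rw [Finset.sum_comm]
  exact Finset.sum_congr rfl fun i _ => Finset.sum_congr rfl fun j _ => by
    simp only [gram, Matrix.of_apply]
    ring

theorem inner_coordField {c y : M}
    (hy : y ∈ (trivializationAt (Model n) (fun x : M => TangentSpace I x) c).baseSet)
    (v : TangentSpace I y) (j : Fin n) :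
    D.g.inner y v (coordField I c j y) = ∑ i, gram D c y i j * coord I c y v i := by
  rw [inner_eq_sum_gram D hy]
  simp [coord_coordField hy]

/-- A kernel vector of the Gram matrix would be the component vector of a nonzero tangent vector of
length zero. -/
theorem isUnit_det_gram (x : M) : IsUnit (gram D x x).det := by
  have hx := mem_baseSet_self (I := I) x
  rw [isUnit_iff_ne_zero]
  intro h
  obtain ⟨a, ha, h0⟩ := Matrix.exists_mulVec_eq_zero_iff.2 h
  apply ha
  set w : TangentSpace I x := ∑ i, a i • coordField I x i x with hw
  have hc : ∀ k, coord I x x w k = a k := by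
    intro k
    rw [coord_self_eq_coordLin, hw, map_sum]
    simp [← coord_self_eq_coordLin, coord_coordField hx]
  have hww : D.g.inner x w w = 0 := by
    rw [inner_eq_sum_gram D hx]
    refine Finset.sum_eq_zero fun i _ => ?_
    have := congrFun h0 i
    simp only [Matrix.mulVec, dotProduct, Pi.zero_apply] at this
    simp only [hc]
    calc ∑ j, gram D x x i j * a i * a j = a i * ∑ j, gram D x x i j * a j := by
          rw [Finset.mul_sum]
          exact Finset.sum_congr rfl fun j _ => by ring
      _ = 0 := by rw [this, mul_zero]
  have hw0 : w = 0 := by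
    by_contra hne
    exact (D.g.pos x w hne).ne' hww
  funext k
  rw [← hc k, hw0, coord_self_eq_coordLin, map_zero]
  rfl

theorem mvfderiv_eq_sum_partialDeriv (f : M → ℝ) (x : M) (v : TangentSpace I x) :
    mvfderiv I f x v = ∑ i, coord I x x v i * partialDeriv I x i f x := by
  conv_lhs => rw [← sum_coord_smul_coordField
    (mem_baseSet_self x) v]
  simp [partialDeriv]

/-- The Christoffel symbols of the first kind. -/
theorem sum_gram_mul_christoffel (x : M) (i m j : Fin n) :
    ∑ k, gram D x x k j * christoffel D x k i m x
      = (1 / 2) * (partialDeriv I x i (fun z => gram D x z m j) x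
        + partialDeriv I x m (fun z => gram D x z i j) x
        - partialDeriv I x j (fun z => gram D x z i m) x) := by
  set G : Fin n → ℝ := fun l => (1 / 2) * (partialDeriv I x i (fun z => gram D x z m l) x
        + partialDeriv I x m (fun z => gram D x z i l) x
        - partialDeriv I x l (fun z => gram D x z i m) x) with hG
  have h1 : ∀ k, christoffel D x k i m x = ((gram D x x)⁻¹.mulVec G) k := by
    intro k
    simp only [christoffel, Matrix.mulVec, dotProduct, hG, Finset.mul_sum]
    exact Finset.sum_congr rfl fun l _ => by ring
  have h2 : ∑ k, gram D x x k j * christoffel D x k i m x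
      = ((gram D x x).mulVec ((gram D x x)⁻¹.mulVec G)) j := by
    simp only [Matrix.mulVec, dotProduct, h1]
    exact Finset.sum_congr rfl fun k _ => by rw [gram_symm D x x k j]
  rw [h2, Matrix.mulVec_mulVec, Matrix.mul_nonsing_inv _ (isUnit_det_gram D x),
    Matrix.one_mulVec]

theorem partialDeriv_gram_symm (x : M) (l i j : Fin n) :
    partialDeriv I x l (fun z => gram D x z i j) x
      = partialDeriv I x l (fun z => gram D x z j i) x := by
  simp only [gram_symm D x _ i j]

theorem coord_nabla (Y : ∀ y : M, TangentSpace I y) (x : M) (v : TangentSpace I x) (k : Fin n) :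
    coord I x x (nabla D Y x v) k = mvfderiv I (fun y => coord I x y (Y y) k) x v
      + ∑ i, ∑ j, christoffel D x k i j x * coord I x x v i * coord I x x (Y x) j := by
  rw [coord_self_eq_coordLin, nabla, map_sum]
  simp [← coord_self_eq_coordLin, coord_coordField (mem_baseSet_self x)]

/-- The components `g(∇_{∂_i} Y, ∂_j)`. -/
def nablaComp (Y : ∀ y : M, TangentSpace I y) (x : M) (i j : Fin n) : ℝ :=
  ∑ k, gram D x x k j * partialDeriv I x i (fun y => coord I x y (Y y) k) x
    + ∑ m, coord I x x (Y x) m * ((1 / 2) * (partialDeriv I x i (fun z => gram D x z m j) x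
        + partialDeriv I x m (fun z => gram D x z i j) x
        - partialDeriv I x j (fun z => gram D x z i m) x))

theorem sum_mul_nablaComp (Y : ∀ y : M, TangentSpace I y) (x : M) (i : Fin n) (b : Fin n → ℝ) :
    ∑ j, b j * nablaComp D Y x i j
      = ∑ k, ∑ j, (gram D x x k j * b j * partialDeriv I x i (fun y => coord I x y (Y y) k) x
        + coord I x x (Y x) k * b j * ((1 / 2) * (partialDeriv I x i (fun z => gram D x z k j) x
          + partialDeriv I x k (fun z => gram D x z i j) x
          - partialDeriv I x j (fun z => gram D x z i k) x))) := by
  rw [Finset.sum_comm]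
  refine Finset.sum_congr rfl fun j _ => ?_
  rw [nablaComp, ← Finset.sum_add_distrib, Finset.mul_sum]
  exact Finset.sum_congr rfl fun k _ => by ring

theorem inner_nabla (Y : ∀ y : M, TangentSpace I y) (x : M) (v w : TangentSpace I x) :
    D.g.inner x (nabla D Y x v) w
      = ∑ i, ∑ j, coord I x x v i * coord I x x w j * nablaComp D Y x i j := by
  rw [inner_eq_sum_gram D (mem_baseSet_self x)]
  simp only [coord_nabla, mvfderiv_eq_sum_partialDeriv _ x v, nablaComp,
    ← sum_gram_mul_christoffel]
  rw [Finset.sum_comm]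
  conv_rhs => rw [Finset.sum_comm]
  refine Finset.sum_congr rfl fun j _ => ?_
  simp only [mul_add, add_mul, Finset.sum_add_distrib, Finset.mul_sum, Finset.sum_mul]
  congr 1
  · rw [Finset.sum_comm]
    exact Finset.sum_congr rfl fun i _ => Finset.sum_congr rfl fun k _ => by ring
  · rw [Finset.sum_comm]
    refine Finset.sum_congr rfl fun i _ => ?_
    rw [Finset.sum_comm]
    exact Finset.sum_congr rfl fun m _ => Finset.sum_congr rfl fun k _ => by ring

/-- `L_X g` is the symmetrization of `∇X`. -/
theorem lieMetric_eq (X : ∀ y : M, TangentSpace I y) (x : M) (v w : TangentSpace I x) :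
    lieMetric D X x v w = D.g.inner x (nabla D X x v) w + D.g.inner x (nabla D X x w) v := by
  rw [inner_nabla, inner_nabla, lieMetric]
  rw [Finset.sum_comm (f := fun i j => coord I x x w i * coord I x x v j * nablaComp D X x i j),
    ← Finset.sum_add_distrib]
  refine Finset.sum_congr rfl fun i _ => ?_
  rw [← Finset.sum_add_distrib]
  refine Finset.sum_congr rfl fun j _ => ?_
  rw [mul_comm (coord I x x w j), ← mul_add]
  congr 1
  rw [mvfderiv_eq_sum_partialDeriv, nablaComp, nablaComp, add_add_add_comm,
    ← Finset.sum_add_distrib, ← Finset.sum_add_distrib, ← Finset.sum_add_distrib, ← Finset.sum_add_distrib]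
  refine Finset.sum_congr rfl fun m _ => ?_
  -- Symmetrizing the first-kind symbols in i and j cancels ∂_i g_mj and ∂_j g_mi and leaves ∂_m
  -- g_ij.
  rw [gram_symm D x x i m, partialDeriv_gram_symm D x i m j, partialDeriv_gram_symm D x m j i,
    partialDeriv_gram_symm D x j m i]
  ring

/-- The Levi-Civita connection is metric. -/
theorem mvfderiv_inner {Y Z : ∀ y : M, TangentSpace I y} {x : M}
    (hY : MDifferentiableAt I (I.prod 𝓘(ℝ, Model n))
      (fun y => Bundle.TotalSpace.mk' (Model n) (E := fun x : M => TangentSpace I x) y (Y y)) x)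
    (hZ : MDifferentiableAt I (I.prod 𝓘(ℝ, Model n))
      (fun y => Bundle.TotalSpace.mk' (Model n) (E := fun x : M => TangentSpace I x) y (Z y)) x)
    (v : TangentSpace I x) :
    mvfderiv I (fun y => D.g.inner y (Y y) (Z y)) x v
      = D.g.inner x (nabla D Y x v) (Z x) + D.g.inner x (nabla D Z x v) (Y x) := by
  have hG := mdifferentiableAt_gram D x
  have hY' := mdifferentiableAt_coord hY
  have hZ' := mdifferentiableAt_coord hZ
  -- The chart stays fixed at x while y varies, so the expansion holds only near x; this suffices
  -- for a derivative at x.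
  have hev : (fun y => D.g.inner y (Y y) (Z y)) =ᶠ[nhds x] fun y => ∑ i, ∑ j,
      gram D x y i j * coord I x y (Y y) i * coord I x y (Z y) j := by
    filter_upwards [eventually_mem_baseSet (I := I) x] with y hy
    exact inner_eq_sum_gram D hy _ _
  rw [inner_nabla, inner_nabla, mvfderiv_congr hev, mvfderiv_eq_sum_partialDeriv,
    ← Finset.sum_add_distrib]
  refine Finset.sum_congr rfl fun i _ => ?_
  unfold partialDeriv
  have hYZ : ∀ k j, MDifferentiableAt I 𝓘(ℝ, ℝ)
      (fun y => coord I x y (Y y) k * coord I x y (Z y) j) x :=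
    fun k j => mdifferentiableAt_fun_mul (hY' k) (hZ' j)
  simp only [mul_assoc, ← Finset.mul_sum]
  rw [← mul_add]
  congr 1
  rw [mvfderiv_finset_sum _ fun k _ => mdifferentiableAt_finset_sum _ fun j _ =>
    mdifferentiableAt_fun_mul (hG k j) (hYZ k j), sum_apply, sum_mul_nablaComp, sum_mul_nablaComp,
    Finset.sum_comm (f := fun k j => gram D x x k j * coord I x x (Y x) j * _ + _),
    ← Finset.sum_add_distrib]
  refine Finset.sum_congr rfl fun k _ => ?_
  rw [mvfderiv_finset_sum _ fun j _ => mdifferentiableAt_fun_mul (hG k j) (hYZ k j), sum_apply,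
    ← Finset.sum_add_distrib]
  refine Finset.sum_congr rfl fun j _ => ?_
  -- The two first-kind symbols, for (k, j) and (j, k), add up to ∂_i g_kj, the derivative of the
  -- metric coefficient.
  rw [mvfderiv_fun_mul_apply (hG k j) (hYZ k j), mvfderiv_fun_mul_apply (hY' k) (hZ' j),
    gram_symm D x x j k, partialDeriv_gram_symm D x i j k, partialDeriv_gram_symm D x j i k]
  simp only [partialDeriv]
  ring

/-- The Leibniz rule for an expansion known only near x, as is the case for the shift vector in a
local frame. -/
theorem nabla_eq_sum {ι : Type*} [Fintype ι] {X : ∀ y : M, TangentSpace I y}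
    {f : ι → M → ℝ} {e : ι → ∀ y : M, TangentSpace I y} {x : M}
    (hX : ∀ᶠ y in nhds x, X y = ∑ a, f a y • e a y)
    (hf : ∀ a, MDifferentiableAt I 𝓘(ℝ, ℝ) (f a) x)
    (he : ∀ a, MDifferentiableAt I (I.prod 𝓘(ℝ, Model n))
      (fun y => Bundle.TotalSpace.mk' (Model n) (E := fun x : M => TangentSpace I x) y (e a y)) x)
    (v : TangentSpace I x) :
    nabla D X x v = ∑ a, (mvfderiv I (f a) x v • e a x + f a x • nabla D (e a) x v) := by
  refine eq_of_coord_eq fun k => ?_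
  have hev : (fun y => coord I x y (X y) k) =ᶠ[nhds x]
      fun y => ∑ a, f a y * coord I x y (e a y) k := by
    filter_upwards [eventually_mem_baseSet (I := I) x, hX] with y hy hXy
    rw [hXy, coord_eq_coordLin hy, map_sum]
    simp [coord_eq_coordLin hy]
  have hX0 : ∀ j, coord I x x (X x) j = ∑ a, f a x * coord I x x (e a x) j := by
    intro j
    rw [hX.self_of_nhds, coord_self_eq_coordLin, map_sum]
    simp [coord_self_eq_coordLin]
  have hR : coord I x x (∑ a, (mvfderiv I (f a) x v • e a x + f a x • nabla D (e a) x v)) k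
      = ∑ a, (mvfderiv I (f a) x v * coord I x x (e a x) k
        + f a x * coord I x x (nabla D (e a) x v) k) := by
    simp only [coord_self_eq_coordLin, map_sum, map_add, map_smul, smul_eq_mul]
  rw [hR, coord_nabla, mvfderiv_congr hev, mvfderiv_finset_sum _ fun a _ =>
    mdifferentiableAt_fun_mul (hf a) (mdifferentiableAt_coord (he a) k), sum_apply]
  simp only [coord_nabla, hX0, Finset.mul_sum, mul_add]
  rw [Finset.sum_comm_cycle, ← Finset.sum_add_distrib]
  refine Finset.sum_congr rfl fun a _ => ?_
  rw [mvfderiv_fun_mul_apply (hf a) (mdifferentiableAt_coord (he a) k), ← add_assoc]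
  congr 1
  · ring
  · exact Finset.sum_congr rfl fun i _ => Finset.sum_congr rfl fun j _ => by ring

end Coordinates


/-! ### Quadratic functions of a spinor, and the equality case -/

section Quadratic

/-- Puts N in the form Re ⟨Tψ, ψ⟩ with T = 1, so that one derivative formula covers N and every Xʲ.
-/
theorem norm_sq_eq_re_inner {Δ : Type*} [NormedAddCommGroup Δ] [InnerProductSpace ℂ Δ] :
    (fun ψ : Δ => ‖ψ‖ ^ 2)
    = fun ψ : Δ => (inner ℂ ((1 : Module.End ℂ Δ) ψ) ψ).re :=
  funext fun ψ => (inner_self_eq_norm_sq (𝕜 := ℂ) ψ).symm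

variable {n : ℕ} {Δ : Type*} [NormedAddCommGroup Δ] [InnerProductSpace ℂ Δ]
  [FiniteDimensional ℂ Δ] (A : SpinorModule n Δ)

theorem contDiff_re_inner (T : Module.End ℂ Δ) {m : WithTop ℕ∞} :
    ContDiff ℝ m fun ψ : Δ => (inner ℂ (T ψ) ψ).re := by
  have hT : ContDiff ℝ m fun ψ : Δ => T ψ :=
    ((LinearMap.toContinuousLinearMap T).restrictScalars ℝ).contDiff
  exact Complex.reCLM.contDiff.comp (hT.inner ℂ contDiff_id)

theorem hasFDerivAt_re_inner (T : Module.End ℂ Δ) (ψ : Δ) :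
    ∃ L : Δ →L[ℝ] ℝ, HasFDerivAt (fun ψ : Δ => (inner ℂ (T ψ) ψ).re) L ψ ∧
      ∀ η, L η = (inner ℂ (T η) ψ).re + (inner ℂ (T ψ) η).re := by
  have hT : HasFDerivAt (fun ψ : Δ => T ψ)
      ((LinearMap.toContinuousLinearMap T).restrictScalars ℝ) ψ :=
    ((LinearMap.toContinuousLinearMap T).restrictScalars ℝ).hasFDerivAt
  refine ⟨_, Complex.reCLM.hasFDerivAt.comp ψ (hT.inner ℂ (hasFDerivAt_id ψ)), fun η => ?_⟩
  simp [fderivInnerCLM_apply, add_comm]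

/-- The equality case of `μ N ≥ |J| |X|`. -/
theorem mul_add_mul_eq_zero_of_sum_sq_le {X J : Fin n → ℝ} {N μ : ℝ}
    (hX : ∑ j, X j ^ 2 ≤ N ^ 2) (hJ : ∑ j, J j ^ 2 ≤ μ ^ 2) (h : μ * N + ∑ j, J j * X j = 0)
    (j : Fin n) : μ * X j + N * J j = 0 := by
  have hs : ∑ j, (μ * X j + N * J j) ^ 2
      = μ ^ 2 * ∑ j, X j ^ 2 + 2 * μ * N * ∑ j, J j * X j + N ^ 2 * ∑ j, J j ^ 2 := by
    simp only [Finset.mul_sum, ← Finset.sum_add_distrib]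
    exact Finset.sum_congr rfl fun j _ => by ring
  have h0 : ∑ j, (μ * X j + N * J j) ^ 2 ≤ 0 := by
    -- The cross term becomes −2μ²N², while each of the outer terms is at most μ²N².
    rw [hs, eq_neg_of_add_eq_zero_right h]
    nlinarith [mul_le_mul_of_nonneg_left hX (sq_nonneg μ),
      mul_le_mul_of_nonneg_left hJ (sq_nonneg N)]
  have := (Finset.sum_eq_zero_iff_of_nonneg fun i _ => sq_nonneg _).1
    (le_antisymm h0 (Finset.sum_nonneg fun i _ => sq_nonneg _)) j (Finset.mem_univ j)
  exact pow_eq_zero_iff two_ne_zero |>.1 this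

end Quadratic

/-! ### Orthonormal frames at a point -/

section Frames

variable {n : ℕ} {H : Type*} [TopologicalSpace H] {I : ModelWithCorners ℝ (Model n) H}
  {M : Type*} [TopologicalSpace M] [ChartedSpace H M] [IsManifold I ∞ M] (D : InitialData I M)
  {x : M} {e : Fin n → TangentSpace I x}

theorem eq_of_inner_eq {u u' : TangentSpace I x}
    (h : ∀ w, D.g.inner x u w = D.g.inner x u' w) : u = u' := by
  by_contra hne
  refine (D.g.pos x (u - u') (sub_ne_zero.2 hne)).ne' ?_
  have hsub : D.g.inner x (u - u') = D.g.inner x u - D.g.inner x u' := map_sub _ _ _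
  rw [hsub, sub_apply, h, sub_self]

theorem inner_sum_smul_frame (he : ∀ i j, D.g.inner x (e i) (e j) = if i = j then 1 else 0)
    (a : Fin n → ℝ) (j : Fin n) : D.g.inner x (∑ i, a i • e i) (e j) = a j := by
  simp [map_sum, sum_apply, he]

theorem sum_inner_smul_frame (he : ∀ i j, D.g.inner x (e i) (e j) = if i = j then 1 else 0)
    (w : TangentSpace I x) : ∑ i, D.g.inner x w (e i) • e i = w := by
  have hli : LinearIndependent ℝ e := by
    rw [Fintype.linearIndependent_iff]
    intro a ha i
    rw [← inner_sum_smul_frame D he a i, ha, map_zero]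
    rfl
  have : FiniteDimensional ℝ (TangentSpace I x) :=
    inferInstanceAs (FiniteDimensional ℝ (Model n))
  have hspan := hli.span_eq_top_of_card_eq_finrank'
    (by rw [Fintype.card_fin]; exact (finrank_euclideanSpace_fin (𝕜 := ℝ)).symm)
  have hw : w ∈ Submodule.span ℝ (Set.range e) := hspan ▸ Submodule.mem_top
  obtain ⟨a, rfl⟩ := (Submodule.mem_span_range_iff_exists_fun ℝ).1 hw
  simp only [inner_sum_smul_frame D he]

theorem current_sum_smul (a : Fin n → ℝ) :
    current D x (∑ i, a i • e i) = ∑ i, a i * current D x (e i) := by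
  simp only [current, coord_self_eq_coordLin, map_sum, map_smul, smul_eq_mul, Finset.mul_sum]
  rw [Finset.sum_comm]
  exact Finset.sum_congr rfl fun i _ => Finset.sum_congr rfl fun j _ => by ring

/-- The inverse metric in terms of an orthonormal frame. -/
theorem gram_inv_apply (he : ∀ i j, D.g.inner x (e i) (e j) = if i = j then 1 else 0)
    (i j : Fin n) : (gram D x x)⁻¹ i j = ∑ b, coord I x x (e b) i * coord I x x (e b) j := by
  have h : (Matrix.of fun i j => ∑ b, coord I x x (e b) i * coord I x x (e b) j) * gram D x x
      = 1 := by
    ext i j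
    have hj := sum_inner_smul_frame D he (coordField I x j x)
    have hc : coord I x x (∑ b, D.g.inner x (coordField I x j x) (e b) • e b) i
        = if i = j then 1 else 0 := by
      rw [hj, coord_coordField (mem_baseSet_self x)]
    rw [coord_self_eq_coordLin, map_sum] at hc
    rw [Matrix.one_apply, ← hc]
    simp only [Matrix.mul_apply, Matrix.of_apply, map_smul, smul_eq_mul, Finset.sum_mul,
      ← coord_self_eq_coordLin]
    rw [Finset.sum_comm]
    refine Finset.sum_congr rfl fun b _ => ?_
    rw [D.g.symm, inner_coordField D (mem_baseSet_self x), Finset.sum_mul]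
    exact Finset.sum_congr rfl fun k _ => by ring
  rw [Matrix.inv_eq_left_inv h]
  rfl

/-- Carries the energy condition from chart components to frame components, where X is defined. -/
theorem currentNorm_eq (he : ∀ i j, D.g.inner x (e i) (e j) = if i = j then 1 else 0) :
    currentNorm D x = Real.sqrt (∑ b, current D x (e b) ^ 2) := by
  rw [currentNorm]
  congr 1
  simp only [gram_inv_apply D he, current, sq, Finset.sum_mul, Finset.mul_sum]
  rw [Finset.sum_comm_cycle]
  exact Finset.sum_congr rfl fun b _ => Finset.sum_congr rfl fun i _ =>
    Finset.sum_congr rfl fun j _ => by ring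

end Frames

/-! ### Lapse, shift and current of a spinor field -/

section SpinorFields

variable {n : ℕ} {H : Type*} [TopologicalSpace H] {I : ModelWithCorners ℝ (Model n) H}
  {M : Type*} [TopologicalSpace M] [ChartedSpace H M] [IsManifold I ∞ M]
  {D : InitialData I M} {κ : Type*} {Δ : Type*} [NormedAddCommGroup Δ]
  [InnerProductSpace ℂ Δ] [FiniteDimensional ℂ Δ]
  {S : SpinStructure D κ} {A : SpinorModule n Δ} (φ : Spinor S A) {a : κ} {x : M}

/-- The index `S.indexAt x` may jump with x. Unitarity of the transition functions allows one fixed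
frame on a whole neighbourhood, as differentiation requires. -/
theorem lapse_eq (hx : x ∈ S.U a) : lapse φ x = ‖φ.rep a x‖ ^ 2 := by
  have hb : x ∈ S.U (S.indexAt x) ∩ S.U a := ⟨S.mem_U x, hx⟩
  rw [lapse, φ.transition _ _ x hb, inner_spinRep_of_mem_spinGroup A (S.σ_mem _ _ x hb)]
  exact inner_self_eq_norm_sq (𝕜 := ℂ) _

/-- The cocycle lifts the change of frame, so pairings with every tangent vector w agree in the two
frames. -/
theorem shift_eq (hx : x ∈ S.U a) :
    shift φ x = ∑ j, spinorVector A (φ.rep a x) j • S.e a j x := by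
  have hb : x ∈ S.U (S.indexAt x) ∩ S.U a := ⟨S.mem_U x, hx⟩
  refine eq_of_inner_eq D fun w => ?_
  have h := sum_mul_spinorVector_of_mem_spinGroup A (S.σ_mem _ _ x hb) (S.σ_lift _ _ x hb w)
    (φ.rep a x)
  rw [← φ.transition _ _ x hb] at h
  simp only [frameCoord] at h
  have hs : ∀ c, D.g.inner x (∑ j, spinorVector A (φ.rep c x) j • S.e c j x) w
      = ∑ j, D.g.inner x w (S.e c j x) * spinorVector A (φ.rep c x) j := by
    intro c
    rw [D.g.symm, map_sum]
    exact Finset.sum_congr rfl fun j _ => by rw [map_smul, smul_eq_mul, mul_comm]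
  rw [hs a, ← h]
  exact hs _

theorem eventually_mem_U (hx : x ∈ S.U a) : ∀ᶠ y in nhds x, y ∈ S.U a :=
  (S.isOpen_U a).mem_nhds hx

theorem contMDiffAt_shift (x : M) : ContMDiffAt I (I.prod 𝓘(ℝ, Model n)) 1
    (fun y => Bundle.TotalSpace.mk' (Model n) (E := fun x : M => TangentSpace I x) y (shift φ y))
    x := by
  set a := S.indexAt x with ha
  have hU := (S.isOpen_U a).mem_nhds (S.mem_U x)
  have hs : ∀ j, ContMDiffAt I (I.prod 𝓘(ℝ, Model n)) 1
      (fun y => Bundle.TotalSpace.mk' (Model n) (E := fun x : M => TangentSpace I x) y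
        (spinorVector A (φ.rep a y) j • S.e a j y)) x := by
    intro j
    refine ContMDiffAt.smul_section (f := fun y => spinorVector A (φ.rep a y) j)
      (s := fun y => S.e a j y) ?_ ?_
    · exact (contDiff_re_inner (e0 A * eS A j)).contMDiff.contMDiffAt.comp x
        ((φ.contMDiffOn a).contMDiffAt hU)
    · exact ((S.e_contMDiffOn a j).contMDiffAt hU).of_le (by simp)
  refine (ContMDiffAt.sum_section (s := Finset.univ) fun j _ => hs j).congr_of_eventuallyEq ?_
  filter_upwards [hU] with y hy
  rw [shift_eq φ hy]

theorem mdifferentiableAt_frame (hx : x ∈ S.U a) (i : Fin n) :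
    MDifferentiableAt I (I.prod 𝓘(ℝ, Model n))
      (fun y => Bundle.TotalSpace.mk' (Model n) (E := fun x : M => TangentSpace I x) y
        (S.e a i y)) x :=
  ((S.e_contMDiffOn a i).contMDiffAt ((S.isOpen_U a).mem_nhds hx)).mdifferentiableAt (by simp)

theorem mdifferentiableAt_rep (hx : x ∈ S.U a) : MDifferentiableAt I 𝓘(ℝ, Δ) (φ.rep a) x :=
  ((φ.contMDiffOn a).contMDiffAt ((S.isOpen_U a).mem_nhds hx)).mdifferentiableAt (by simp)

/-- The connection form of the Levi-Civita connection in an orthonormal frame is antisymmetric. -/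
theorem inner_nabla_frame_antisymm (hx : x ∈ S.U a) (v : TangentSpace I x) (i j : Fin n) :
    D.g.inner x (nabla D (S.e a i) x v) (S.e a j x)
      = -D.g.inner x (nabla D (S.e a j) x v) (S.e a i x) := by
  have h := mvfderiv_inner D (mdifferentiableAt_frame hx i) (mdifferentiableAt_frame hx j) v
  have hev : (fun y => D.g.inner y (S.e a i y) (S.e a j y))
      =ᶠ[nhds x] fun _ => if i = j then 1 else 0 := by
    filter_upwards [eventually_mem_U hx] with y hy
    exact S.e_orthonormal a y hy i j
  rw [mvfderiv_congr hev, mvfderiv_const, zero_apply] at h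
  linarith

theorem mvfderiv_rep_of_isParallel (h : IsParallel φ) (hx : x ∈ S.U a) (v : TangentSpace I x) :
    mvfderiv I (φ.rep a) x v
      = parallelRhs A (fun i j => D.g.inner x (nabla D (S.e a i) x v) (S.e a j x))
        (fun j => D.p x v (S.e a j x)) (φ.rep a x) := by
  have := h a x hx v
  rw [spacetimeNabla, spinNabla, sub_eq_zero] at this
  exact eq_sub_of_add_eq this

theorem mdifferentiableAt_re_inner_rep (T : Module.End ℂ Δ) (hx : x ∈ S.U a) :
    MDifferentiableAt I 𝓘(ℝ, ℝ) (fun y => (inner ℂ (T (φ.rep a y)) (φ.rep a y)).re) x :=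
  ((contDiff_re_inner T (m := 1)).differentiable (by simp) _).mdifferentiableAt.comp x
    (mdifferentiableAt_rep φ hx)

theorem mvfderiv_re_inner_rep (T : Module.End ℂ Δ) (hx : x ∈ S.U a) (v : TangentSpace I x) :
    mvfderiv I (fun y => (inner ℂ (T (φ.rep a y)) (φ.rep a y)).re) x v
      = (inner ℂ (T (mvfderiv I (φ.rep a) x v)) (φ.rep a x)).re
        + (inner ℂ (T (φ.rep a x)) (mvfderiv I (φ.rep a) x v)).re := by
  obtain ⟨L, hL, hL'⟩ := hasFDerivAt_re_inner T (φ.rep a x)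
  rw [mvfderiv_comp_hasFDerivAt hL (mdifferentiableAt_rep φ hx), hL']

theorem mdifferentiableAt_spinorVector (hx : x ∈ S.U a) (j : Fin n) :
    MDifferentiableAt I 𝓘(ℝ, ℝ) (fun y => spinorVector A (φ.rep a y) j) x :=
  mdifferentiableAt_re_inner_rep φ (e0 A * eS A j) hx

theorem mdifferentiableAt_norm_sq (hx : x ∈ S.U a) :
    MDifferentiableAt I 𝓘(ℝ, ℝ) (fun y => ‖φ.rep a y‖ ^ 2) x := by
  have h := mdifferentiableAt_re_inner_rep φ 1 hx
  exact (funext fun y => (congrFun norm_sq_eq_re_inner (φ.rep a y)) :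
    (fun y => ‖φ.rep a y‖ ^ 2) = _) ▸ h

theorem mvfderiv_spinorVector_of_isParallel (h : IsParallel φ) (hx : x ∈ S.U a)
    (v : TangentSpace I x) (k : Fin n) :
    mvfderiv I (fun y => spinorVector A (φ.rep a y) k) x v
      = ∑ j, D.g.inner x (nabla D (S.e a k) x v) (S.e a j x) * spinorVector A (φ.rep a x) j
        - D.p x v (S.e a k x) * ‖φ.rep a x‖ ^ 2 := by
  rw [← re_inner_e0_eS_parallelRhs A (inner_nabla_frame_antisymm hx v)
    (fun j => D.p x v (S.e a j x)) k, ← mvfderiv_rep_of_isParallel φ h hx v]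
  exact mvfderiv_re_inner_rep φ (e0 A * eS A k) hx v

theorem mvfderiv_norm_sq_of_isParallel (h : IsParallel φ) (hx : x ∈ S.U a)
    (v : TangentSpace I x) :
    mvfderiv I (fun y => ‖φ.rep a y‖ ^ 2) x v
      = -∑ j, D.p x v (S.e a j x) * spinorVector A (φ.rep a x) j := by
  rw [← two_mul_re_inner_parallelRhs A (inner_nabla_frame_antisymm hx v)
    (fun j => D.p x v (S.e a j x)), ← mvfderiv_rep_of_isParallel φ h hx v,
    (funext fun y => congrFun norm_sq_eq_re_inner (φ.rep a y) :
      (fun y => ‖φ.rep a y‖ ^ 2) = _), mvfderiv_re_inner_rep φ 1 hx v, two_mul]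
  congr 1
  exact inner_re_symm (𝕜 := ℂ) _ _

/-- `∇_v X = -N p(v, ·)` for a parallel spinor. -/
theorem inner_nabla_shift_of_isParallel (h : IsParallel φ) (x : M) (v w : TangentSpace I x) :
    D.g.inner x (nabla D (shift φ) x v) w = -(lapse φ x * D.p x v w) := by
  have hx := S.mem_U x
  set a := S.indexAt x with ha
  have he := S.e_orthonormal a x hx
  have hn := nabla_eq_sum D (X := shift φ) (f := fun j y => spinorVector A (φ.rep a y) j)
    (e := S.e a) ((eventually_mem_U hx).mono fun y hy => shift_eq φ hy)
    (mdifferentiableAt_spinorVector φ hx) (mdifferentiableAt_frame hx) v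
  have hb : ∀ b, D.g.inner x (nabla D (shift φ) x v) (S.e a b x)
      = -(lapse φ x * D.p x v (S.e a b x)) := by
    intro b
    rw [hn, Finset.sum_add_distrib, map_add, add_apply, inner_sum_smul_frame D he,
      mvfderiv_spinorVector_of_isParallel φ h hx, lapse_eq φ hx, map_sum, sum_apply]
    -- Differentiating the components gives Σ θ_bj Xʲ and differentiating the frame gives Σ θ_jb Xʲ;
    -- these are opposite.
    have : ∑ j, D.g.inner x (nabla D (S.e a b) x v) (S.e a j x) * spinorVector A (φ.rep a x) j
        = -∑ j, D.g.inner x (spinorVector A (φ.rep a x) j • nabla D (S.e a j) x v) (S.e a b x) := by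
      rw [← Finset.sum_neg_distrib]
      refine Finset.sum_congr rfl fun j _ => ?_
      rw [inner_nabla_frame_antisymm hx, map_smul, smul_apply, smul_eq_mul]
      ring
    rw [this]
    ring
  rw [← sum_inner_smul_frame D he w]
  simp only [map_sum, map_smul, hb, smul_eq_mul, Finset.mul_sum, ← Finset.sum_neg_distrib]
  exact Finset.sum_congr rfl fun b _ => by ring

theorem inner_shift_shift (hx : x ∈ S.U a) :
    D.g.inner x (shift φ x) (shift φ x)
      = ∑ j, spinorVector A (φ.rep a x) j * spinorVector A (φ.rep a x) j := by
  conv_lhs => rw [shift_eq φ hx, map_sum]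
  exact Finset.sum_congr rfl fun j _ => by
    rw [map_smul, inner_sum_smul_frame D (S.e_orthonormal a x hx), smul_eq_mul]

theorem hasMFDerivAt_lapse_sq_sub_shift_sq (h : IsParallel φ) (x : M) :
    HasMFDerivAt I 𝓘(ℝ, ℝ)
      (fun y => lapse φ y ^ 2 - D.g.inner y (shift φ y) (shift φ y)) x 0 := by
  have hx := S.mem_U x
  set a := S.indexAt x with ha
  set F : M → ℝ := fun y => ‖φ.rep a y‖ ^ 2 * ‖φ.rep a y‖ ^ 2
    - ∑ j, spinorVector A (φ.rep a y) j * spinorVector A (φ.rep a y) j with hF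
  have hev : (fun y => lapse φ y ^ 2 - D.g.inner y (shift φ y) (shift φ y)) =ᶠ[nhds x] F := by
    filter_upwards [eventually_mem_U hx] with y hy
    rw [hF, lapse_eq φ hy, inner_shift_shift φ hy, sq (‖φ.rep a y‖ ^ 2)]
  have hN := mdifferentiableAt_norm_sq φ hx
  have hX := mdifferentiableAt_spinorVector φ hx
  have hNN := mdifferentiableAt_fun_mul hN hN
  have hXX := mdifferentiableAt_finset_sum Finset.univ fun j _ =>
    mdifferentiableAt_fun_mul (hX j) (hX j)
  have hFd : MDifferentiableAt I 𝓘(ℝ, ℝ) F x := hNN.sub hXX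
  have h0 : mvfderiv I F x = 0 := by
    ext v
    rw [hF, mvfderiv_fun_sub hNN hXX, mvfderiv_finset_sum _ fun j _ =>
      mdifferentiableAt_fun_mul (hX j) (hX j), sub_apply, sum_apply,
      mvfderiv_fun_mul_apply hN hN, mvfderiv_norm_sq_of_isParallel φ h hx]
    simp only [mvfderiv_fun_mul_apply (hX _) (hX _), mvfderiv_spinorVector_of_isParallel φ h hx]
    set q : Fin n → ℝ := fun j => D.p x v (S.e a j x)
    set f : Fin n → ℝ := spinorVector A (φ.rep a x)
    -- This is the antisymmetric form θ evaluated on (X, X).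
    have hanti : ∑ j, f j * ∑ i, D.g.inner x (nabla D (S.e a j) x v) (S.e a i x) * f i = 0 := by
      have : ∑ j, f j * ∑ i, D.g.inner x (nabla D (S.e a j) x v) (S.e a i x) * f i
          = -∑ j, f j * ∑ i, D.g.inner x (nabla D (S.e a j) x v) (S.e a i x) * f i := by
        simp only [Finset.mul_sum]
        conv_lhs => rw [Finset.sum_comm]
        simp only [← Finset.sum_neg_distrib]
        refine Finset.sum_congr rfl fun i _ => Finset.sum_congr rfl fun j _ => ?_
        rw [inner_nabla_frame_antisymm hx]
        ring
      linarith
    have hq : ∑ j, f j * (q j * ‖φ.rep a x‖ ^ 2) = ‖φ.rep a x‖ ^ 2 * ∑ j, q j * f j := by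
      rw [Finset.mul_sum]
      exact Finset.sum_congr rfl fun j _ => by ring
    simp only [mul_sub, Finset.sum_add_distrib, Finset.sum_sub_distrib]
    change _ - ((∑ j, f j * ∑ i, D.g.inner x (nabla D (S.e a j) x v) (S.e a i x) * f i
      - ∑ j, f j * (q j * ‖φ.rep a x‖ ^ 2)) + (∑ j, f j * ∑ i,
        D.g.inner x (nabla D (S.e a j) x v) (S.e a i x) * f i
      - ∑ j, f j * (q j * ‖φ.rep a x‖ ^ 2))) = (0 : ℝ)
    rw [hanti, hq]
    ring
  refine HasMFDerivAt.congr_of_eventuallyEq ?_ hev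
  have := hFd.hasMFDerivAt
  rwa [show mfderiv I 𝓘(ℝ, ℝ) F x = 0 from h0] at this

theorem mu_mul_lapse_add_current_shift (h : VanishingConstraint φ) (x : M) :
    mu D x * lapse φ x + current D x (shift φ x) = 0 := by
  have hx := S.mem_U x
  set a := S.indexAt x
  have h0 := h a x hx
  simp only [energyMomentum, inner_sub_left, inner_real_smul_left, sum_inner, Complex.sub_re,
    Complex.smul_re, Complex.re_sum, re_inner_eS_e0, smul_eq_mul, mul_neg,
    Finset.sum_neg_distrib, sub_neg_eq_add] at h0
  have hN : (inner ℂ (φ.rep a x) (φ.rep a x)).re = ‖φ.rep a x‖ ^ 2 :=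
    inner_self_eq_norm_sq (𝕜 := ℂ) _
  rw [hN] at h0
  rw [lapse_eq φ hx, shift_eq φ hx, current_sum_smul, ← h0]
  congr 1
  exact Finset.sum_congr rfl fun j _ => mul_comm _ _

theorem mu_mul_inner_shift_add_lapse_mul_current (hD : InteriorDEC D) (h : VanishingConstraint φ)
    (x : M) (v : TangentSpace I x) :
    mu D x * D.g.inner x (shift φ x) v + lapse φ x * current D x v = 0 := by
  have hx := S.mem_U x
  set a := S.indexAt x
  have he := S.e_orthonormal a x hx
  have hd := hD x
  have hμ : 0 ≤ mu D x := (Real.sqrt_nonneg _).trans hd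
  have hJ : ∑ j, current D x (S.e a j x) ^ 2 ≤ mu D x ^ 2 := by
    rw [currentNorm_eq D he] at hd
    exact (Real.sqrt_le_left hμ).1 hd
  have h0 := mu_mul_lapse_add_current_shift φ h x
  rw [lapse_eq φ hx, shift_eq φ hx, current_sum_smul] at h0
  simp only [mul_comm (spinorVector A _ _)] at h0
  -- The two bounds |X| ≤ N and |J| ≤ μ are forced into equality by μN + J(X) = 0.
  have hb := mul_add_mul_eq_zero_of_sum_sq_le (sum_spinorVector_sq_le A (φ.rep a x)) hJ h0
  rw [← sum_inner_smul_frame D he v, current_sum_smul, lapse_eq φ hx, shift_eq φ hx]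
  simp only [map_sum, map_smul, smul_eq_mul, Finset.mul_sum, ← Finset.sum_add_distrib]
  refine Finset.sum_eq_zero fun j _ => ?_
  have := inner_sum_smul_frame D he (spinorVector A (φ.rep a x)) j
  simp only [map_sum, map_smul] at this
  rw [this]
  linear_combination D.g.inner x v (S.e a j x) * hb j

end SpinorFields

end InitialDataSpin

end

/-! ### The main theorem -/

theorem mainTheorem5 {n : ℕ} {H : Type*} [TopologicalSpace H]
    (I : ModelWithCorners ℝ (InitialDataSpin.Model n) H)
    {M : Type*} [TopologicalSpace M] [ChartedSpace H M] [IsManifold I ∞ M]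
    (D : InitialDataSpin.InitialData I M)
    {κ : Type*} (S : InitialDataSpin.SpinStructure D κ)
    {Δ : Type*} [NormedAddCommGroup Δ] [InnerProductSpace ℂ Δ] [FiniteDimensional ℂ Δ]
    (A : InitialDataSpin.SpinorModule n Δ)
    (φ : InitialDataSpin.Spinor S A) :
    (InitialDataSpin.IsParallel φ →
      ContMDiff I (I.prod 𝓘(ℝ, InitialDataSpin.Model n)) 1
        (fun x => Bundle.TotalSpace.mk' (InitialDataSpin.Model n)
          (E := fun x : M => TangentSpace I x) x (InitialDataSpin.shift φ x)) ∧
      (∀ (x : M) (v w : TangentSpace I x),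
        InitialDataSpin.lieMetric D (InitialDataSpin.shift φ) x v w
          + 2 * InitialDataSpin.lapse φ x * D.p x v w = 0) ∧
      (∀ x : M, HasMFDerivAt I 𝓘(ℝ, ℝ)
        (fun y => InitialDataSpin.lapse φ y ^ 2
          - D.g.inner y (InitialDataSpin.shift φ y) (InitialDataSpin.shift φ y)) x 0)) ∧
    (InitialDataSpin.InteriorDEC D → InitialDataSpin.VanishingConstraint φ →
      (∀ x : M, InitialDataSpin.mu D x * InitialDataSpin.lapse φ x
        + InitialDataSpin.current D x (InitialDataSpin.shift φ x) = 0) ∧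
      (∀ (x : M) (v : TangentSpace I x),
        InitialDataSpin.mu D x * D.g.inner x (InitialDataSpin.shift φ x) v
          + InitialDataSpin.lapse φ x * InitialDataSpin.current D x v = 0)) := by
  refine ⟨fun h => ⟨fun x => InitialDataSpin.contMDiffAt_shift φ x, fun x v w => ?_,
    InitialDataSpin.hasMFDerivAt_lapse_sq_sub_shift_sq φ h⟩, fun hD h =>
    ⟨InitialDataSpin.mu_mul_lapse_add_current_shift φ h,
      InitialDataSpin.mu_mul_inner_shift_add_lapse_mul_current φ hD h⟩⟩
  rw [InitialDataSpin.lieMetric_eq, InitialDataSpin.inner_nabla_shift_of_isParallel φ h,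
    InitialDataSpin.inner_nabla_shift_of_isParallel φ h, D.p_symm x w v]
  ring
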